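/- Let $G$ be a finite non-empty graph (parallel edges and loops allowed, connectedness not required) that is cubic (every vertex has degree $3$, a loop counting twice), bridgeless (no edge is such that its deletion separates its two ends) and planar (it can be drawn in $\mathbb{R}^2$ without crossings, the edges being simple polygonal curves). Then the girth of $G$, i.e. the length of a shortest cycle, is at most $5$; here a loop is a cycle of length $1$ and two parallel edges form a cycle of length $2$. Moreover, in every such drawing of $G$ there is a face (a connected component of the complement of the drawing) that has at most $5$ edges on its boundary, and among these boundary edges there are the edges of a cycle of $G$, which therefore has length at most $5$. -/

import Mathlib

open Set
open scoped Graph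

/-! ### Multigraphs: cubic, bridgeless, cycles, girth

Graphs are Mathlib's multigraphs `Graph α β`; parallel edges and loops are allowed. -/

namespace Graph

variable {α β : Type*}

/-- A graph is cubic if every vertex has degree three, a loop counting twice. -/
def IsCubic (G : Graph α β) : Prop :=
  ∀ x ∈ V(G), (G.incidenceSet x).encard + (G.loopSet x).encard = 3

/-- An edge is a bridge if, after it is deleted, no walk joins its two ends. -/
def IsBridge (G : Graph α β) (e : β) : Prop :=
  ∃ x y, G.IsLink e x y ∧ ¬ Relation.ReflTransGen (G.deleteEdges {e}).Adj x y

/-- A graph is bridgeless if none of its edges is a bridge. -/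
def IsBridgeless (G : Graph α β) : Prop :=
  ∀ e, ¬ G.IsBridge e

/-- A cycle of length `n ≥ 1`: distinct vertices `v 0, …, v (n - 1)` and distinct edges
`e 0, …, e (n - 1)`, where `e i` joins `v i` to its cyclic successor. A loop is a cycle of
length one, two parallel edges form a cycle of length two. -/
structure IsCycle (G : Graph α β) (n : ℕ) (v : Fin n → α) (e : Fin n → β) : Prop where
  pos : 0 < n
  vertex_injective : Function.Injective v
  edge_injective : Function.Injective e
  isLink : ∀ i, G.IsLink (e i) (v i) (v (finRotate n i))

/-- The girth: the length of a shortest cycle, `⊤` if there is no cycle. -/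
noncomputable def egirth (G : Graph α β) : ℕ∞ :=
  ⨅ (n : ℕ) (_ : ∃ v e, G.IsCycle n v e), (n : ℕ∞)

/-! ### Drawings in the plane -/

/-- The polygonal curve through the points `p 0, p 1, p 2, …`: for a natural number `i` and
`s ∈ [0, 1)`, at time `i + s` it is at `(1 - s) • p i + s • p (i + 1)`. -/
noncomputable def polygonalCurve (p : ℕ → ℝ × ℝ) (t : ℝ) : ℝ × ℝ :=
  AffineMap.lineMap (p ⌊t⌋₊) (p (⌊t⌋₊ + 1)) (Int.fract t)

/-- A drawing of `G` in the plane without crossings. Distinct vertices are distinct points;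
every edge is a polygonal curve of finitely many segments between its ends, without
self-intersections; the interior of an edge contains no vertex and no point of another edge.
(The curve of a loop is closed.) -/
structure PlaneDrawing (G : Graph α β) where
  /-- The position of a vertex. -/
  point : α → ℝ × ℝ
  /-- The number of segments of an edge. -/
  segments : β → ℕ
  /-- The successive corners of an edge; those numbered `0, …, segments e` are relevant. -/
  corner : β → ℕ → ℝ × ℝ
  point_injOn : InjOn point V(G)
  segments_pos : ∀ e ∈ E(G), 0 < segments e
  ends : ∀ e ∈ E(G), ∃ x y, G.IsLink e x y ∧
    corner e 0 = point x ∧ corner e (segments e) = point y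
  curve_injOn : ∀ e ∈ E(G), InjOn (polygonalCurve (corner e)) (Ioo 0 (segments e : ℝ))
  vertex_notMem : ∀ e ∈ E(G), ∀ x ∈ V(G),
    point x ∉ polygonalCurve (corner e) '' Ioo 0 (segments e : ℝ)
  edge_disjoint : ∀ e ∈ E(G), ∀ f ∈ E(G), e ≠ f →
    Disjoint (polygonalCurve (corner e) '' Ioo 0 (segments e : ℝ))
      (polygonalCurve (corner f) '' Ioo 0 (segments f : ℝ))

/-- A graph is planar if it can be drawn in the plane without crossings. -/
def IsPlanar (G : Graph α β) : Prop := Nonempty G.PlaneDrawing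

namespace PlaneDrawing

variable {G : Graph α β} (D : G.PlaneDrawing)

/-- The set of points of an edge, end points included. -/
def arc (e : β) : Set (ℝ × ℝ) :=
  polygonalCurve (D.corner e) '' Icc 0 (D.segments e : ℝ)

/-- The set of points of the drawing. -/
def support : Set (ℝ × ℝ) :=
  D.point '' V(G) ∪ ⋃ e ∈ E(G), D.arc e

/-- The faces: the connected components of the complement of the drawing. -/
def faces : Set (Set (ℝ × ℝ)) :=
  {F | ∃ z ∈ D.supportᶜ, F = connectedComponentIn D.supportᶜ z}

/-- The edges that surround a face: those that lie on its boundary. -/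
def boundaryEdges (F : Set (ℝ × ℝ)) : Set β :=
  {e ∈ E(G) | D.arc e ⊆ frontier F}

end PlaneDrawing

end Graph

/-!
For a plane drawing cut into segments, let each cycle `z` with complex coefficients act on a point
`p` off the drawing by `∑ i, z i * w i p`, where `w i p` is the integral of `dζ / (ζ - p)` along the
segment `i`. This is constant on each face and jumps by `2πi * z i` across the segment `i`, so that
cycles, together with the constants, embed into the functions on the set of faces. This gives the
inequality `E + 1 ≤ F + V`, without any connectedness. As `3 V ≤ 2 E` and each edge lies on the
boundary of at most two faces, double counting yields a face with at most five boundary edges.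

The edges along which this face borders on the rest of the complement are boundary edges. They never
end alone at a vertex, because a small disc minus a radius is connected, so that following them
yields a cycle.
-/

open Filter Topology

section OpenPartition

variable {X : Type*} [TopologicalSpace X] {U F F' H : Set X}

/-- The connected components of a subspace `U`, as sets of points of the whole space. -/
def componentsIn (U : Set X) : Set (Set X) :=
  {C | ∃ x ∈ U, C = connectedComponentIn U x}

/-- A partition of `U` into two open sets, such as a component and the union of the others. The
set `closure F ∩ closure F'` is where the two parts border on each other. -/
structure IsOpenPartition (U F F' : Set X) : Prop where
  isOpen_left : IsOpen F
  isOpen_right : IsOpen F'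
  disjoint : Disjoint F F'
  union_eq : F ∪ F' = U

namespace IsOpenPartition

theorem symm (h : IsOpenPartition U F F') : IsOpenPartition U F' F :=
  ⟨h.isOpen_right, h.isOpen_left, h.disjoint.symm, union_comm F' F ▸ h.union_eq⟩

theorem left_subset (h : IsOpenPartition U F F') : F ⊆ U :=
  subset_union_left.trans h.union_eq.le

theorem subset_left_of_inter_nonempty (h : IsOpenPartition U F F') (hH : IsPreconnected H)
    (hHU : H ⊆ U) (hHF : (H ∩ F).Nonempty) : H ⊆ F :=
  hH.subset_left_of_subset_union h.isOpen_left h.isOpen_right h.disjoint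
    (hHU.trans h.union_eq.ge) hHF

theorem closure_inter_closure_subset_compl (h : IsOpenPartition U F F') :
    closure F ∩ closure F' ⊆ Uᶜ := by
  rintro x ⟨hxF, hxF'⟩ hxU
  rcases h.union_eq.ge hxU with hx | hx
  · exact disjoint_left.1 (h.disjoint.closure_right h.isOpen_left) hx hxF'
  · exact disjoint_left.1 (h.disjoint.closure_left h.isOpen_right) hxF hx

theorem closure_inter_closure_subset_frontier (h : IsOpenPartition U F F') :
    closure F ∩ closure F' ⊆ frontier F := by
  rintro x ⟨hxF, hxF'⟩
  rw [h.isOpen_left.frontier_eq]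
  exact ⟨hxF, disjoint_right.1 (h.disjoint.closure_right h.isOpen_left) hxF'⟩

/-- `closure F` and `closure F'` are closed and cover the space. -/
theorem nonempty_inter_closure_inter_closure (h : IsOpenPartition U F F') (hU : Dense U)
    (hH : IsPreconnected H) (hF : (H ∩ F).Nonempty) (hF' : (H ∩ F').Nonempty) :
    (H ∩ (closure F ∩ closure F')).Nonempty := by
  refine isPreconnected_closed_iff.1 hH _ _ isClosed_closure isClosed_closure ?_
    (hF.mono (inter_subset_inter_right H subset_closure))
    (hF'.mono (inter_subset_inter_right H subset_closure))
  rw [← closure_union, h.union_eq, hU.closure_eq]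
  exact subset_univ H

end IsOpenPartition

theorem subset_of_mem_componentsIn (hF : F ∈ componentsIn U) : F ⊆ U := by
  obtain ⟨y, -, rfl⟩ := hF
  exact connectedComponentIn_subset U y

theorem nonempty_of_mem_componentsIn (hF : F ∈ componentsIn U) : F.Nonempty := by
  obtain ⟨y, hy, rfl⟩ := hF
  exact ⟨y, mem_connectedComponentIn hy⟩

theorem diff_nonempty_of_nontrivial_componentsIn (hF : F ∈ componentsIn U)
    (hU : (componentsIn U).Nontrivial) : (U \ F).Nonempty := by
  obtain ⟨z, -, rfl⟩ := hF
  obtain ⟨-, ⟨y, hy, rfl⟩, hne⟩ := hU.exists_ne (connectedComponentIn U z)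
  exact ⟨y, hy, fun hyz => hne (connectedComponentIn_eq hyz).symm⟩

theorem eq_connectedComponentIn_of_inter_nonempty (hF : F ∈ componentsIn U)
    (hH : IsPreconnected H) (hHU : H ⊆ U) (hHF : (H ∩ F).Nonempty) {x : X} (hx : x ∈ H) :
    F = connectedComponentIn U x := by
  obtain ⟨y, -, rfl⟩ := hF
  obtain ⟨z, hzH, hz⟩ := hHF
  rw [connectedComponentIn_eq hz]
  exact connectedComponentIn_eq (hH.subset_connectedComponentIn hzH hHU hx)

theorem isOpenPartition_of_mem_componentsIn [LocallyConnectedSpace X] (hU : IsOpen U)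
    (hF : F ∈ componentsIn U) : IsOpenPartition U F (U \ F) := by
  obtain ⟨x, -, rfl⟩ := hF
  refine ⟨hU.connectedComponentIn, ?_, disjoint_sdiff_right,
    union_sdiff_cancel (connectedComponentIn_subset U x)⟩
  have hdiff : U \ connectedComponentIn U x =
      ⋃ y ∈ U \ connectedComponentIn U x, connectedComponentIn U y := by
    refine Subset.antisymm (fun y hy => mem_biUnion hy (mem_connectedComponentIn hy.1)) ?_
    refine iUnion₂_subset fun y hy z hz => ⟨connectedComponentIn_subset U y hz, fun hz' => hy.2 ?_⟩
    rw [connectedComponentIn_eq hz', ← connectedComponentIn_eq hz]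
    exact mem_connectedComponentIn hy.1
  rw [hdiff]
  exact isOpen_biUnion fun y _ => hU.connectedComponentIn

end OpenPartition

theorem starConvex_diff_segment {E : Type*} [AddCommGroup E] [Module ℝ E] {s : Set E}
    (hs : Convex ℝ s) {p p' : E} (hp : p ∈ s) (hp' : p' ∉ s) {ε : ℝ} (hε : 0 < ε)
    (hεs : p + (-ε) • (p' - p) ∈ s) :
    StarConvex ℝ (p + (-ε) • (p' - p)) (s \ segment ℝ p p') := by
  have hv : p' - p ≠ 0 := fun h => hp' (sub_eq_zero.1 h ▸ hp)
  have mem_segment : ∀ x, x ∈ segment ℝ p p' ↔ ∃ t ∈ Icc (0 : ℝ) 1, p + t • (p' - p) = x := by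
    simp only [segment_eq_image', mem_image, implies_true]
  have not_mem_ray : ∀ q ∈ s \ segment ℝ p p', ∀ τ : ℝ, 0 ≤ τ → p + τ • (p' - p) ≠ q := by
    rintro q ⟨hqs, hq⟩ τ hτ rfl
    have hτ1 : 1 < τ := not_le.1 fun h => hq ((mem_segment _).2 ⟨τ, ⟨hτ, h⟩, rfl⟩)
    refine hp' (hs.segment_subset hp hqs ?_)
    rw [segment_eq_image']
    refine ⟨τ⁻¹, ⟨by positivity, inv_le_one_of_one_le₀ hτ1.le⟩, ?_⟩
    simp [inv_smul_smul₀ (by positivity : τ ≠ 0)]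
  rintro q hq a b ha hb hab
  refine ⟨hs hεs hq.1 ha hb hab, fun hmem => ?_⟩
  obtain ⟨t, ht, h⟩ := (mem_segment _).1 hmem
  obtain rfl : a = 1 - b := by linarith
  rcases hb.eq_or_lt with rfl | hb
  · have : t = -ε := smul_left_injective ℝ hv (add_left_cancel (h.trans (by simp)))
    linarith [ht.1]
  · refine not_mem_ray q hq ((t + (1 - b) * ε) / b) (by have := ht.1; positivity) ?_
    rw [← smul_right_inj hb.ne', smul_add, smul_smul, mul_div_cancel₀ _ hb.ne']
    linear_combination (norm := module) h

theorem isPreconnected_diff_segment {E : Type*} [AddCommGroup E] [Module ℝ E] [TopologicalSpace E]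
    [ContinuousAdd E] [ContinuousSMul ℝ E] {s : Set E} (hs : Convex ℝ s) {p p' : E}
    (hp : s ∈ 𝓝 p) (hp' : p' ∉ s) : IsPreconnected (s \ segment ℝ p p') := by
  obtain ⟨ε, hε, hεs⟩ : ∃ ε > (0 : ℝ), p + (-ε) • (p' - p) ∈ s := by
    have hcont : Tendsto (fun ε : ℝ => p + (-ε) • (p' - p)) (𝓝[>] 0) (𝓝 p) := by
      refine tendsto_nhdsWithin_of_tendsto_nhds (Continuous.tendsto' (by fun_prop) _ _ ?_)
      simp
    exact ((eventually_mem_nhdsWithin (s := Ioi (0 : ℝ))).and (hcont hp)).exists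
  have hstar := starConvex_diff_segment hs (mem_of_mem_nhds hp) hp' hε hεs
  rcases (s \ segment ℝ p p').eq_empty_or_nonempty with hempty | hne
  · exact hempty ▸ isPreconnected_empty
  · exact (hstar.isPathConnected (hstar.mem hne)).isConnected.isPreconnected

section UnitSegment

variable {w : ℂ}

theorem mem_segment_zero_one_iff : w ∈ segment ℝ 0 1 ↔ w.im = 0 ∧ w.re ∈ Icc 0 1 := by
  simp only [segment_eq_image', mem_image, sub_zero, zero_add, Complex.real_smul, mul_one]
  constructor
  · rintro ⟨t, ht, rfl⟩
    exact ⟨Complex.ofReal_im t, ht⟩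
  · rintro ⟨him, hre⟩
    exact ⟨w.re, hre, Complex.ext (Complex.ofReal_re _) him.symm⟩

theorem mem_openSegment_zero_one_iff : w ∈ openSegment ℝ 0 1 ↔ w.im = 0 ∧ w.re ∈ Ioo 0 1 := by
  simp only [openSegment_eq_image', mem_image, sub_zero, zero_add, Complex.real_smul, mul_one]
  constructor
  · rintro ⟨t, ht, rfl⟩
    exact ⟨Complex.ofReal_im t, ht⟩
  · rintro ⟨him, hre⟩
    exact ⟨w.re, hre, Complex.ext (Complex.ofReal_re _) him.symm⟩

end UnitSegment

/-- A family of nondegenerate segments in the plane that meet in common ends only, that is, a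
plane straight-line drawing. -/
structure SegmentDrawing (ι : Type*) where
  src : ι → ℝ × ℝ
  tgt : ι → ℝ × ℝ
  src_ne_tgt : ∀ i, src i ≠ tgt i
  disjoint : ∀ i j, i ≠ j → Disjoint (openSegment ℝ (src i) (tgt i)) (segment ℝ (src j) (tgt j))

namespace SegmentDrawing

variable {ι : Type*} (S : SegmentDrawing ι)

/-- The closed segment with index `i`. -/
def seg (i : ι) : Set (ℝ × ℝ) := segment ℝ (S.src i) (S.tgt i)

/-- The open segment with index `i`. -/
def openSeg (i : ι) : Set (ℝ × ℝ) := openSegment ℝ (S.src i) (S.tgt i)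

/-- The set of the two ends of a segment. -/
def ends (i : ι) : Set (ℝ × ℝ) := {S.src i, S.tgt i}

/-- The set of points of the drawing. -/
def support : Set (ℝ × ℝ) := ⋃ i, S.seg i

/-- The vertices of the drawing: the ends of its segments. -/
def endpoints : Set (ℝ × ℝ) := ⋃ i, S.ends i

section Basic

variable {i j : ι} {p q : ℝ × ℝ}

theorem openSeg_subset_seg : S.openSeg i ⊆ S.seg i := openSegment_subset_segment ℝ _ _

theorem seg_subset_support : S.seg i ⊆ S.support := subset_iUnion S.seg i

theorem ends_union_openSeg : S.ends i ∪ S.openSeg i = S.seg i := by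
  rw [ends, insert_union, singleton_union]
  exact insert_endpoints_openSegment ℝ _ _

theorem ends_subset_seg : S.ends i ⊆ S.seg i :=
  subset_union_left.trans S.ends_union_openSeg.le

theorem ends_subset_endpoints : S.ends i ⊆ S.endpoints := subset_iUnion S.ends i

theorem closure_openSeg : closure (S.openSeg i) = S.seg i := closure_openSegment _ _

theorem isClosed_seg : IsClosed (S.seg i) := S.closure_openSeg ▸ isClosed_closure

theorem eq_of_mem_openSeg_of_mem_seg (hi : p ∈ S.openSeg i) (hj : p ∈ S.seg j) : i = j :=
  by_contra fun hij => disjoint_left.1 (S.disjoint i j hij) hi hj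

theorem mem_ends_of_mem_seg (hi : p ∈ S.ends i) (hj : p ∈ S.seg j) : p ∈ S.ends j := by
  rcases S.ends_union_openSeg.ge hj with hj' | hj'
  · exact hj'
  · exact S.eq_of_mem_openSeg_of_mem_seg hj' (S.ends_subset_seg hi) ▸ hi

variable [Finite ι]

theorem isClosed_support : IsClosed S.support := isClosed_iUnion_of_finite fun _ => S.isClosed_seg

theorem finite_endpoints : S.endpoints.Finite :=
  finite_iUnion fun _ => (finite_singleton _).insert _

theorem eventually_mem_seg_imp (p : ℝ × ℝ) : ∀ᶠ q in 𝓝 p, ∀ j, q ∈ S.seg j → p ∈ S.seg j := by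
  refine eventually_all.2 fun j => ?_
  by_cases hp : p ∈ S.seg j
  · exact Eventually.of_forall fun q _ => hp
  · filter_upwards [S.isClosed_seg.isOpen_compl.mem_nhds hp] with q hq hq'
    exact absurd hq' hq

theorem eventually_mem_endpoints_imp_eq (p : ℝ × ℝ) : ∀ᶠ q in 𝓝 p, q ∈ S.endpoints → q = p := by
  have hclosed : IsClosed (S.endpoints \ {p}) := S.finite_endpoints.sdiff.isClosed
  filter_upwards [hclosed.isOpen_compl.mem_nhds fun hp => hp.2 rfl] with q hq hqS
  exact by_contra fun hqp => hq ⟨hqS, hqp⟩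

end Basic

section Coord

variable {i : ι} {p q : ℝ × ℝ}

/-- The complex affine coordinate on the plane in which the segment `i` runs from `0` to `1`. -/
noncomputable def coord (i : ι) : (ℝ × ℝ) ≃ᴬ[ℝ] ℂ :=
  (ContinuousAffineEquiv.constVAdd ℝ (ℝ × ℝ) (-S.src i)).trans <|
    (Complex.equivRealProdCLM.symm.trans <| ContinuousLinearEquiv.smulLeft <|
      Units.mk0 (Complex.equivRealProdCLM.symm (S.tgt i - S.src i))⁻¹ <| inv_ne_zero <|
        (map_ne_zero_iff _ (ContinuousLinearEquiv.injective _)).2 <|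
          sub_ne_zero.2 (S.src_ne_tgt i).symm).toContinuousAffineEquiv

theorem coord_apply (i : ι) (q : ℝ × ℝ) : S.coord i q =
    (Complex.equivRealProdCLM.symm (S.tgt i - S.src i))⁻¹ *
      Complex.equivRealProdCLM.symm (q - S.src i) := by
  rw [sub_eq_neg_add q]
  rfl

theorem coord_src (i : ι) : S.coord i (S.src i) = 0 := by
  rw [coord_apply, sub_self, map_zero, mul_zero]

theorem coord_tgt (i : ι) : S.coord i (S.tgt i) = 1 := by
  rw [coord_apply]
  exact inv_mul_cancel₀ <| (map_ne_zero_iff _ (ContinuousLinearEquiv.injective _)).2 <|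
    sub_ne_zero.2 (S.src_ne_tgt i).symm

theorem continuous_coord (i : ι) : Continuous (S.coord i) := (S.coord i).continuous

theorem mem_seg_iff : q ∈ S.seg i ↔ (S.coord i q).im = 0 ∧ (S.coord i q).re ∈ Icc 0 1 := by
  have himage : S.coord i '' S.seg i = segment ℝ 0 1 := by
    rw [← S.coord_src i, ← S.coord_tgt i]
    exact image_segment ℝ (S.coord i).toAffineMap _ _
  rw [← mem_segment_zero_one_iff, ← himage, (S.coord i).injective.mem_set_image]

theorem mem_openSeg_iff : q ∈ S.openSeg i ↔ (S.coord i q).im = 0 ∧ (S.coord i q).re ∈ Ioo 0 1 := by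
  have himage : S.coord i '' S.openSeg i = openSegment ℝ 0 1 := by
    rw [← S.coord_src i, ← S.coord_tgt i]
    exact image_openSegment ℝ (S.coord i).toAffineMap _ _
  rw [← mem_openSegment_zero_one_iff, ← himage, (S.coord i).injective.mem_set_image]

/-- The open half-plane on the left of the segment `i`. -/
def leftSide (i : ι) : Set (ℝ × ℝ) := {q | 0 < (S.coord i q).im}

/-- The open half-plane on the right of the segment `i`. -/
def rightSide (i : ι) : Set (ℝ × ℝ) := {q | (S.coord i q).im < 0}

theorem convex_leftSide : Convex ℝ (S.leftSide i) :=
  (convex_halfSpace_im_gt 0).affine_preimage (S.coord i).toAffineMap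

theorem convex_rightSide : Convex ℝ (S.rightSide i) :=
  (convex_halfSpace_im_lt 0).affine_preimage (S.coord i).toAffineMap

theorem mem_closure_leftSide (hp : (S.coord i p).im = 0) : p ∈ closure (S.leftSide i) := by
  have hclosure := (S.coord i).toHomeomorph.preimage_closure {w | 0 < w.im}
  rw [Complex.closure_setOfPred_lt_im] at hclosure
  exact hclosure.le hp.ge

theorem mem_closure_rightSide (hp : (S.coord i p).im = 0) : p ∈ closure (S.rightSide i) := by
  have hclosure := (S.coord i).toHomeomorph.preimage_closure {w | w.im < 0}
  rw [Complex.closure_setOfPred_im_lt] at hclosure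
  exact hclosure.le hp.le

variable [Finite ι]

theorem eventually_mem_support_iff (hp : p ∈ S.openSeg i) :
    ∀ᶠ q in 𝓝 p, q ∈ S.support ↔ (S.coord i q).im = 0 := by
  have hre : ∀ᶠ q in 𝓝 p, (S.coord i q).re ∈ Ioo 0 1 :=
    (Complex.continuous_re.comp (S.continuous_coord i)).continuousAt.eventually_mem
      (Ioo_mem_nhds (S.mem_openSeg_iff.1 hp).2.1 (S.mem_openSeg_iff.1 hp).2.2)
  filter_upwards [hre, S.eventually_mem_seg_imp p] with q hre hseg
  constructor
  · intro hq
    obtain ⟨j, hj⟩ := mem_iUnion.1 hq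
    obtain rfl := S.eq_of_mem_openSeg_of_mem_seg hp (hseg j hj)
    exact (S.mem_seg_iff.1 hj).1
  · exact fun him => S.seg_subset_support (S.openSeg_subset_seg (S.mem_openSeg_iff.2 ⟨him, hre⟩))

theorem exists_two_sides (hp : p ∈ S.openSeg i) :
    ∃ U H₁ H₂ : Set (ℝ × ℝ), IsOpen U ∧ p ∈ U ∧ IsPreconnected H₁ ∧ IsPreconnected H₂ ∧
      U \ S.support = H₁ ∪ H₂ ∧ U ∩ S.support ⊆ closure H₁ ∩ closure H₂ := by
  obtain ⟨r, hr, hsupport⟩ := Metric.eventually_nhds_iff_ball.1 (S.eventually_mem_support_iff hp)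
  refine ⟨Metric.ball p r, Metric.ball p r ∩ S.leftSide i, Metric.ball p r ∩ S.rightSide i,
    Metric.isOpen_ball, Metric.mem_ball_self hr,
    ((convex_ball p r).inter S.convex_leftSide).isPreconnected,
    ((convex_ball p r).inter S.convex_rightSide).isPreconnected, ?_, ?_⟩
  · ext q
    rw [← inter_union_distrib_left, mem_inter_iff, Set.mem_sdiff]
    refine and_congr_right fun hq => ?_
    rw [hsupport q hq, ← Ne, ← lt_or_lt_iff_ne, or_comm]
    rfl
  · rintro q ⟨hq, hqS⟩
    have him := (hsupport q hq).1 hqS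
    exact ⟨Metric.isOpen_ball.inter_closure ⟨hq, S.mem_closure_leftSide him⟩,
      Metric.isOpen_ball.inter_closure ⟨hq, S.mem_closure_rightSide him⟩⟩

theorem dense_compl_support : Dense S.supportᶜ := by
  intro p
  by_cases hp : p ∈ S.support
  · obtain ⟨i, hi⟩ := mem_iUnion.1 hp
    rw [← S.closure_openSeg] at hi
    refine closure_minimal (fun q hq => ?_) isClosed_closure hi
    obtain ⟨U, H₁, H₂, -, hqU, -, -, hU, hsupport⟩ := S.exists_two_sides hq
    have hH₁ : H₁ ⊆ S.supportᶜ := fun x hx => (hU.ge (Or.inl hx)).2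
    exact closure_mono hH₁ (hsupport ⟨hqU, S.seg_subset_support (S.openSeg_subset_seg hq)⟩).1
  · exact subset_closure hp

end Coord

section OpenPartition

variable {F F' : Set (ℝ × ℝ)} {i : ι} {p : ℝ × ℝ}

theorem exists_mem_seg_of_mem_closure_inter_closure (h : IsOpenPartition S.supportᶜ F F')
    (hp : p ∈ closure F ∩ closure F') : ∃ i, p ∈ S.seg i :=
  mem_iUnion.1 (not_not.1 (h.closure_inter_closure_subset_compl hp))

variable [Finite ι]

/-- Near an interior point of a segment only two sets make up the complement of the drawing, and
each of them lies in a single part and has all points of the segment in its closure. -/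
theorem eventually_mem_closure_iff (h : IsOpenPartition S.supportᶜ F F') (hp : p ∈ S.openSeg i) :
    ∀ᶠ q in 𝓝[S.openSeg i] p, q ∈ closure F ↔ p ∈ closure F := by
  obtain ⟨U, H₁, H₂, hUo, hpU, hH₁, hH₂, hU, hsupport⟩ := S.exists_two_sides hp
  have mem_closure_iff_of_mem : ∀ q ∈ U ∩ S.openSeg i, q ∈ closure F ↔ H₁ ⊆ F ∨ H₂ ⊆ F := by
    rintro q ⟨hqU, hqi⟩
    have hclosure := hsupport ⟨hqU, S.seg_subset_support (S.openSeg_subset_seg hqi)⟩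
    constructor
    · intro hq
      obtain ⟨x, hxU, hxF⟩ := mem_closure_iff.1 hq U hUo hqU
      refine (hU.le ⟨hxU, h.left_subset hxF⟩).imp (fun hx => ?_) fun hx => ?_
      · exact h.subset_left_of_inter_nonempty hH₁ (fun y hy => (hU.ge (Or.inl hy)).2) ⟨x, hx, hxF⟩
      · exact h.subset_left_of_inter_nonempty hH₂ (fun y hy => (hU.ge (Or.inr hy)).2) ⟨x, hx, hxF⟩
    · rintro (hHF | hHF)
      · exact closure_mono hHF hclosure.1
      · exact closure_mono hHF hclosure.2
  filter_upwards [inter_mem_nhdsWithin _ (hUo.mem_nhds hpU)] with q hq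
  rw [mem_closure_iff_of_mem q hq.symm, mem_closure_iff_of_mem p ⟨hpU, hp⟩]

theorem seg_subset_closure (h : IsOpenPartition S.supportᶜ F F') (hp : p ∈ S.openSeg i)
    (hpF : p ∈ closure F) : S.seg i ⊆ closure F := by
  rw [← S.closure_openSeg]
  refine closure_minimal (fun q hq => ?_) isClosed_closure
  have hpq : p ∈ closure F ↔ q ∈ closure F :=
    (convex_openSegment (𝕜 := ℝ) (S.src i) (S.tgt i)).isPreconnected.induction₂
      (fun x y => x ∈ closure F ↔ y ∈ closure F)
      (fun x hx => (S.eventually_mem_closure_iff h hx).mono fun y hy => hy.symm)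
      (fun _ _ _ _ _ _ => Iff.trans) (fun _ _ _ _ => Iff.symm) hp hq
  exact hpq.1 hpF

theorem seg_subset_closure_inter_closure (h : IsOpenPartition S.supportᶜ F F')
    (hp : p ∈ S.openSeg i) (hpJ : p ∈ closure F ∩ closure F') :
    S.seg i ⊆ closure F ∩ closure F' :=
  subset_inter (S.seg_subset_closure h hp hpJ.1) (S.seg_subset_closure h.symm hp hpJ.2)

theorem exists_seg_subset (h : IsOpenPartition S.supportᶜ F F') (hF : F.Nonempty)
    (hF' : F'.Nonempty) : ∃ i, S.seg i ⊆ closure F ∩ closure F' := by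
  have hconn : IsPreconnected S.endpointsᶜ :=
    (S.finite_endpoints.countable.isConnected_compl_of_one_lt_rank
      (by rw [← Module.finrank_eq_rank]; simp)).isPreconnected
  have hsub : S.endpoints ⊆ S.support := iUnion_mono fun i => S.ends_subset_seg
  have hU : F ∪ F' ⊆ S.endpointsᶜ := h.union_eq.le.trans (compl_subset_compl.2 hsub)
  obtain ⟨p, hp, hpJ⟩ := h.nonempty_inter_closure_inter_closure S.dense_compl_support hconn
    (hF.mono fun x hx => ⟨hU (Or.inl hx), hx⟩) (hF'.mono fun x hx => ⟨hU (Or.inr hx), hx⟩)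
  obtain ⟨i, hi⟩ := S.exists_mem_seg_of_mem_closure_inter_closure h hpJ
  rcases S.ends_union_openSeg.ge hi with hpi | hpi
  · exact absurd (S.ends_subset_endpoints hpi) hp
  · exact ⟨i, S.seg_subset_closure_inter_closure h hpi hpJ⟩

theorem exists_ne_seg_subset (h : IsOpenPartition S.supportᶜ F F') (hp : p ∈ S.ends i)
    (hi : S.seg i ⊆ closure F ∩ closure F') :
    ∃ j ≠ i, p ∈ S.ends j ∧ S.seg j ⊆ closure F ∩ closure F' := by
  obtain ⟨p', hp'p, hp'i, hseg⟩ : ∃ p' ≠ p, p' ∈ S.ends i ∧ S.seg i = segment ℝ p p' := by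
    rcases hp with rfl | rfl
    · exact ⟨_, (S.src_ne_tgt i).symm, Or.inr rfl, rfl⟩
    · exact ⟨_, S.src_ne_tgt i, Or.inl rfl, segment_symm ℝ _ _⟩
  obtain ⟨r, hr, hball⟩ := Metric.eventually_nhds_iff_ball.1
    ((S.eventually_mem_endpoints_imp_eq p).and (S.eventually_mem_seg_imp p))
  have hconn : IsPreconnected (Metric.ball p r \ S.seg i) := by
    rw [hseg]
    exact isPreconnected_diff_segment (convex_ball p r) (Metric.ball_mem_nhds p hr) fun hp' =>
      hp'p ((hball p' hp').1 (S.ends_subset_endpoints hp'i))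
  have inter_nonempty : ∀ A ⊆ S.supportᶜ, p ∈ closure A →
      ((Metric.ball p r \ S.seg i) ∩ A).Nonempty := by
    intro A hA hpA
    obtain ⟨x, hx, hxA⟩ := mem_closure_iff.1 hpA _ Metric.isOpen_ball (Metric.mem_ball_self hr)
    exact ⟨x, ⟨hx, fun hxi => hA hxA (S.seg_subset_support hxi)⟩, hxA⟩
  have hpJ := hi (S.ends_subset_seg hp)
  obtain ⟨q, ⟨hqr, hqi⟩, hqJ⟩ := h.nonempty_inter_closure_inter_closure S.dense_compl_support
    hconn (inter_nonempty F h.left_subset hpJ.1) (inter_nonempty F' h.symm.left_subset hpJ.2)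
  obtain ⟨j, hj⟩ := S.exists_mem_seg_of_mem_closure_inter_closure h hqJ
  refine ⟨j, fun hji => hqi (hji ▸ hj), S.mem_ends_of_mem_seg hp ((hball q hqr).2 j hj), ?_⟩
  rcases S.ends_union_openSeg.ge hj with hqj | hqj
  · have hqp := (hball q hqr).1 (S.ends_subset_endpoints hqj)
    exact absurd (S.ends_subset_seg hp) (hqp ▸ hqi)
  · exact S.seg_subset_closure_inter_closure h hqj hqJ

theorem encard_componentsIn_closure_le_two (hp : p ∈ S.openSeg i) :
    {F ∈ componentsIn S.supportᶜ | p ∈ closure F}.encard ≤ 2 := by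
  obtain ⟨U, H₁, H₂, hUo, hpU, hH₁, hH₂, hU, hsupport⟩ := S.exists_two_sides hp
  have hclosure := hsupport ⟨hpU, S.seg_subset_support (S.openSeg_subset_seg hp)⟩
  obtain ⟨x₁, hx₁⟩ := closure_nonempty_iff.1 ⟨p, hclosure.1⟩
  obtain ⟨x₂, hx₂⟩ := closure_nonempty_iff.1 ⟨p, hclosure.2⟩
  have hsub : {F ∈ componentsIn S.supportᶜ | p ∈ closure F} ⊆
      {connectedComponentIn S.supportᶜ x₁, connectedComponentIn S.supportᶜ x₂} := by
    rintro F ⟨hF, hpF⟩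
    obtain ⟨y, hyU, hyF⟩ := mem_closure_iff.1 hpF U hUo hpU
    refine (hU.le ⟨hyU, subset_of_mem_componentsIn hF hyF⟩).imp (fun hy => ?_) fun hy => ?_
    · exact eq_connectedComponentIn_of_inter_nonempty hF hH₁
        (fun z hz => (hU.ge (Or.inl hz)).2) ⟨y, hy, hyF⟩ hx₁
    · exact eq_connectedComponentIn_of_inter_nonempty hF hH₂
        (fun z hz => (hU.ge (Or.inr hz)).2) ⟨y, hy, hyF⟩ hx₂
  exact (encard_le_encard hsub).trans ((encard_insert_le _ _).trans (by
    rw [encard_singleton, one_add_one_eq_two]))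

end OpenPartition

end SegmentDrawing

section LogRatio

variable {w : ℂ}

theorem im_sub_one_div_self (w : ℂ) : ((w - 1) / w).im = w.im / Complex.normSq w := by
  rcases eq_or_ne w 0 with rfl | hw
  · simp
  · rw [sub_div, div_self hw, Complex.sub_im, Complex.one_im, one_div, Complex.inv_im]
    ring

theorem sub_one_div_self_mem_slitPlane (hw : w ∉ segment ℝ 0 1) :
    (w - 1) / w ∈ Complex.slitPlane := by
  have hw0 : w ≠ 0 := by
    rintro rfl
    exact hw (left_mem_segment ℝ 0 1)
  rw [mem_segment_zero_one_iff] at hw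
  rw [Complex.mem_slitPlane_iff]
  by_cases him : w.im = 0
  · lift w to ℝ using him
    norm_cast at hw hw0 ⊢
    refine Or.inl ?_
    rcases lt_or_gt_of_ne hw0 with hneg | hpos
    · exact div_pos_of_neg_of_neg (by linarith) hneg
    · exact div_pos (by grind) hpos
  · exact Or.inr (by simp [im_sub_one_div_self, him, hw0])

theorem hasDerivAt_log_sub_one_div_self (hw : w ∉ segment ℝ 0 1) :
    HasDerivAt (fun w => Complex.log ((w - 1) / w)) ((w - 1)⁻¹ - w⁻¹) w := by
  have hw0 : w ≠ 0 := by
    rintro rfl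
    exact hw (left_mem_segment ℝ 0 1)
  have hw1 : w - 1 ≠ 0 := by
    intro h
    rw [sub_eq_zero.1 h] at hw
    exact hw (right_mem_segment ℝ 0 1)
  refine ((((hasDerivAt_id w).sub_const 1).div (hasDerivAt_id w) hw0).clog
    (sub_one_div_self_mem_slitPlane hw)).congr_deriv ?_
  simp only [Pi.div_apply, id]
  field_simp

theorem im_sub_one_div_self_eq_zero_of_mem_openSegment (hw : w ∈ openSegment ℝ 0 1) :
    ((w - 1) / w).im = 0 := by
  rw [im_sub_one_div_self, (mem_openSegment_zero_one_iff.1 hw).1, zero_div]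

theorem re_sub_one_div_self_neg_of_mem_openSegment (hw : w ∈ openSegment ℝ 0 1) :
    ((w - 1) / w).re < 0 := by
  obtain ⟨him, h0, h1⟩ := mem_openSegment_zero_one_iff.1 hw
  lift w to ℝ using him
  norm_cast at h0 h1 ⊢
  exact div_neg_of_neg_of_pos (sub_neg.2 h1) h0

theorem continuousAt_sub_one_div_self_of_mem_openSegment (hw : w ∈ openSegment ℝ 0 1) :
    ContinuousAt (fun w : ℂ => (w - 1) / w) w := by
  have hw0 : w ≠ 0 := by
    rintro rfl
    exact (mem_openSegment_zero_one_iff.1 hw).2.1.ne rfl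
  exact (continuousAt_id.sub continuousAt_const).div continuousAt_id hw0

theorem tendsto_log_sub_one_div_self_of_im_pos (hw : w ∈ openSegment ℝ 0 1) :
    Tendsto (fun w => Complex.log ((w - 1) / w)) (𝓝[{w | 0 < w.im}] w)
      (𝓝 (Real.log ‖(w - 1) / w‖ + Real.pi * Complex.I)) := by
  refine (Complex.tendsto_log_nhdsWithin_im_nonneg_of_re_neg_of_im_zero
    (re_sub_one_div_self_neg_of_mem_openSegment hw)
    (im_sub_one_div_self_eq_zero_of_mem_openSegment hw)).comp (tendsto_nhdsWithin_iff.2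
      ⟨(continuousAt_sub_one_div_self_of_mem_openSegment hw).mono_left nhdsWithin_le_nhds, ?_⟩)
  filter_upwards [self_mem_nhdsWithin] with x hx
  exact (im_sub_one_div_self x).ge.trans' (div_nonneg (le_of_lt hx) (Complex.normSq_nonneg x))

theorem tendsto_log_sub_one_div_self_of_im_neg (hw : w ∈ openSegment ℝ 0 1) :
    Tendsto (fun w => Complex.log ((w - 1) / w)) (𝓝[{w | w.im < 0}] w)
      (𝓝 (Real.log ‖(w - 1) / w‖ - Real.pi * Complex.I)) := by
  refine (Complex.tendsto_log_nhdsWithin_im_neg_of_re_neg_of_im_zero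
    (re_sub_one_div_self_neg_of_mem_openSegment hw)
    (im_sub_one_div_self_eq_zero_of_mem_openSegment hw)).comp (tendsto_nhdsWithin_iff.2
      ⟨(continuousAt_sub_one_div_self_of_mem_openSegment hw).mono_left nhdsWithin_le_nhds, ?_⟩)
  filter_upwards [self_mem_nhdsWithin] with x hx
  have hx0 : x ≠ 0 := fun h => by simp [h] at hx
  exact (im_sub_one_div_self x).trans_lt (div_neg_of_neg_of_pos hx (Complex.normSq_pos.2 hx0))

end LogRatio

namespace SegmentDrawing

variable {ι : Type*} (S : SegmentDrawing ι) {i : ι} {p q : ℝ × ℝ}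

open Complex

/-- The integral of `dζ / (ζ - q)` along the segment `i`, whose imaginary part is the angle that
the segment subtends at `q`; it is written in the coordinate in which the segment runs from `0`
to `1`. -/
noncomputable def winding (i : ι) (q : ℝ × ℝ) : ℂ := log ((S.coord i q - 1) / S.coord i q)

theorem coord_sub_one (i : ι) (q : ℝ × ℝ) : S.coord i q - 1 =
    (equivRealProdCLM.symm (S.tgt i - S.src i))⁻¹ * equivRealProdCLM.symm (q - S.tgt i) := by
  rw [← S.coord_tgt i, coord_apply, coord_apply, ← mul_sub, ← map_sub, sub_sub_sub_cancel_right]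

theorem hasFDerivAt_winding (hq : q ∉ S.seg i) :
    HasFDerivAt (S.winding i)
      (((equivRealProdCLM.symm (q - S.tgt i))⁻¹ - (equivRealProdCLM.symm (q - S.src i))⁻¹) •
        (equivRealProdCLM.symm : ℝ × ℝ →L[ℝ] ℂ)) q := by
  set d := equivRealProdCLM.symm (S.tgt i - S.src i) with hd
  have hd0 : d ≠ 0 := (map_ne_zero_iff _ (ContinuousLinearEquiv.injective _)).2 <|
    sub_ne_zero.2 (S.src_ne_tgt i).symm
  rw [mem_seg_iff, ← mem_segment_zero_one_iff] at hq
  have hcoord : HasFDerivAt (S.coord i) (d⁻¹ • (equivRealProdCLM.symm : ℝ × ℝ →L[ℝ] ℂ)) q := by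
    rw [funext (S.coord_apply i)]
    exact ((equivRealProdCLM.symm : ℝ × ℝ →L[ℝ] ℂ).hasFDerivAt.comp q
      ((hasFDerivAt_id q).sub_const (S.src i))).const_mul d⁻¹
  refine ((hasDerivAt_log_sub_one_div_self hq).comp_hasFDerivAt q hcoord).congr_fderiv ?_
  rw [coord_sub_one, coord_apply, ← hd, smul_smul]
  congr 1
  field_simp

theorem tendsto_winding_leftSide (hp : p ∈ S.openSeg i) :
    Tendsto (S.winding i) (𝓝[S.leftSide i] p)
      (𝓝 (Real.log ‖(S.coord i p - 1) / S.coord i p‖ + Real.pi * I)) :=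
  (tendsto_log_sub_one_div_self_of_im_pos
    (mem_openSegment_zero_one_iff.2 (S.mem_openSeg_iff.1 hp))).comp <|
      (S.continuous_coord i).continuousWithinAt.tendsto_nhdsWithin fun _ hq => hq

theorem tendsto_winding_rightSide (hp : p ∈ S.openSeg i) :
    Tendsto (S.winding i) (𝓝[S.rightSide i] p)
      (𝓝 (Real.log ‖(S.coord i p - 1) / S.coord i p‖ - Real.pi * I)) :=
  (tendsto_log_sub_one_div_self_of_im_neg
    (mem_openSegment_zero_one_iff.2 (S.mem_openSeg_iff.1 hp))).comp <|
      (S.continuous_coord i).continuousWithinAt.tendsto_nhdsWithin fun _ hq => hq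

variable [Fintype ι]

/-- The boundary operator from one-dimensional to zero-dimensional chains of the drawing. -/
noncomputable def boundary : (ι → ℂ) →ₗ[ℂ] (ℝ × ℝ →₀ ℂ) :=
  Fintype.linearCombination ℂ fun i => Finsupp.single (S.tgt i) 1 - Finsupp.single (S.src i) 1

theorem linearCombination_boundary (h : ℝ × ℝ → ℂ) (z : ι → ℂ) :
    Finsupp.linearCombination ℂ h (S.boundary z) = ∑ i, z i * (h (S.tgt i) - h (S.src i)) := by
  simp [boundary, Fintype.linearCombination_apply]

theorem finrank_range_boundary_le :
    Module.finrank ℂ (LinearMap.range S.boundary) ≤ S.endpoints.ncard := by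
  have := S.finite_endpoints.fintype
  have hrange : LinearMap.range S.boundary ≤ Finsupp.supported ℂ ℂ S.endpoints := by
    rw [boundary, Fintype.range_linearCombination, Submodule.span_le]
    rintro _ ⟨i, rfl⟩
    exact sub_mem (Finsupp.single_mem_supported ℂ 1 (S.ends_subset_endpoints (Or.inr rfl)))
      (Finsupp.single_mem_supported ℂ 1 (S.ends_subset_endpoints (Or.inl rfl)))
  have e : Finsupp.supported ℂ ℂ S.endpoints ≃ₗ[ℂ] S.endpoints → ℂ :=
    (Finsupp.supportedEquivFinsupp S.endpoints).trans (Finsupp.linearEquivFunOnFinite ℂ ℂ _)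
  have := Module.Finite.equiv e.symm
  calc Module.finrank ℂ (LinearMap.range S.boundary)
      ≤ Module.finrank ℂ (Finsupp.supported ℂ ℂ S.endpoints) := Submodule.finrank_mono hrange
    _ = S.endpoints.ncard := by
      rw [e.finrank_eq, Module.finrank_fintype_fun_eq_card, ← Nat.card_eq_fintype_card]
      rfl

theorem hasFDerivAt_sum_winding {z : ι → ℂ} (hz : S.boundary z = 0) (hq : q ∈ S.supportᶜ) :
    HasFDerivAt (fun q => ∑ i, z i * S.winding i q) (0 : ℝ × ℝ →L[ℝ] ℂ) q := by
  refine (HasFDerivAt.fun_sum fun i _ => (S.hasFDerivAt_winding fun hqi =>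
    hq (S.seg_subset_support hqi)).const_mul (z i)).congr_fderiv ?_
  simp_rw [smul_smul, ← Finset.sum_smul]
  rw [← S.linearCombination_boundary (fun p => (equivRealProdCLM.symm (q - p))⁻¹), hz, map_zero,
    zero_smul]

theorem sum_winding_eq_of_mem_componentsIn {z : ι → ℂ} (hz : S.boundary z = 0)
    {F : Set (ℝ × ℝ)} (hF : F ∈ componentsIn S.supportᶜ) (hp : p ∈ F) (hq : q ∈ F) :
    ∑ i, z i * S.winding i p = ∑ i, z i * S.winding i q := by
  have hderiv : ∀ x ∈ F, HasFDerivAt (fun q => ∑ i, z i * S.winding i q) 0 x := fun x hx =>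
    S.hasFDerivAt_sum_winding hz (subset_of_mem_componentsIn hF hx)
  have hopen := (isOpenPartition_of_mem_componentsIn S.isClosed_support.isOpen_compl hF).isOpen_left
  have hconn : IsPreconnected F := by
    obtain ⟨x, -, rfl⟩ := hF
    exact isPreconnected_connectedComponentIn
  exact hopen.is_const_of_fderiv_eq_zero hconn
    (fun x hx => (hderiv x hx).differentiableAt.differentiableWithinAt)
    (fun x hx => (hderiv x hx).fderiv) hp hq

theorem mul_add_sum_winding_eq_of_tendsto [DecidableEq ι] {z : ι → ℂ} {c l : ℂ}
    (hc : ∀ q ∈ S.supportᶜ, ∑ i, z i * S.winding i q = c) (hp : p ∈ S.openSeg i)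
    {A : Set (ℝ × ℝ)} (hpA : p ∈ closure A) (hA : ∀ᶠ q in 𝓝[A] p, q ∈ S.supportᶜ)
    (hl : Tendsto (S.winding i) (𝓝[A] p) (𝓝 l)) :
    z i * l + ∑ j ∈ Finset.univ.erase i, z j * S.winding j p = c := by
  have := mem_closure_iff_nhdsWithin_neBot.1 hpA
  have hcont : ContinuousAt (fun q => ∑ j ∈ Finset.univ.erase i, z j * S.winding j q) p := by
    refine tendsto_finsetSum _ fun j hj => ?_
    have hpj : p ∉ S.seg j := fun hpj =>
      Finset.ne_of_mem_erase hj (S.eq_of_mem_openSeg_of_mem_seg hp hpj).symm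
    exact ((S.hasFDerivAt_winding hpj).const_mul (z j)).continuousAt
  refine tendsto_nhds_unique ((hl.const_mul (z i)).add (hcont.mono_left nhdsWithin_le_nhds)) ?_
  refine tendsto_const_nhds.congr' (hA.mono fun q hq => ?_)
  rw [← hc q hq]
  exact (Finset.add_sum_erase _ _ (Finset.mem_univ i)).symm

/-- Across the segment `i` the sum jumps by `2πi z i`. -/
theorem eq_zero_of_sum_winding_eq_const {z : ι → ℂ} {c : ℂ}
    (hc : ∀ q ∈ S.supportᶜ, ∑ i, z i * S.winding i q = c) : z = 0 := by
  classical
  funext i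
  obtain ⟨p, hp⟩ : (S.openSeg i).Nonempty := ⟨_, midpoint_mem_openSegment _ _⟩
  have him := (S.mem_openSeg_iff.1 hp).1
  have hsupport := (S.eventually_mem_support_iff hp).filter_mono
    (nhdsWithin_le_nhds (s := S.leftSide i))
  have hsupport' := (S.eventually_mem_support_iff hp).filter_mono
    (nhdsWithin_le_nhds (s := S.rightSide i))
  have hleft := S.mul_add_sum_winding_eq_of_tendsto hc hp (S.mem_closure_leftSide him) (by
    filter_upwards [hsupport, self_mem_nhdsWithin] with q hq hql
    exact fun hqS => hql.ne' (hq.1 hqS)) (S.tendsto_winding_leftSide hp)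
  have hright := S.mul_add_sum_winding_eq_of_tendsto hc hp (S.mem_closure_rightSide him) (by
    filter_upwards [hsupport', self_mem_nhdsWithin] with q hq hqr
    exact fun hqS => hqr.ne (hq.1 hqS)) (S.tendsto_winding_rightSide hp)
  have hjump : z i * (2 * Real.pi * I) = 0 := by linear_combination hleft - hright
  simpa [Real.pi_ne_zero] using hjump

/-- Together with the constants, the cycles embed into the functions on the set of faces. -/
theorem finrank_ker_boundary_add_one_le (hfin : (componentsIn S.supportᶜ).Finite) :
    Module.finrank ℂ (LinearMap.ker S.boundary) + 1 ≤ (componentsIn S.supportᶜ).ncard := by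
  have := hfin.fintype
  choose rep hrep hF using fun F : componentsIn S.supportᶜ => F.2
  let Φ : (LinearMap.ker S.boundary × ℂ) →ₗ[ℂ] (componentsIn S.supportᶜ → ℂ) :=
    { toFun x F := ∑ i, x.1.1 i * S.winding i (rep F) + x.2
      map_add' x y := by
        funext F
        simp only [Prod.fst_add, Prod.snd_add, Submodule.coe_add, Pi.add_apply, add_mul,
          Finset.sum_add_distrib]
        ring
      map_smul' c x := by
        funext F
        simp [mul_add, Finset.mul_sum, mul_assoc] }
  have hΦ : Function.Injective Φ := by
    rw [injective_iff_map_eq_zero]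
    rintro ⟨⟨z, hz⟩, c⟩ h
    have hconst : ∀ q ∈ S.supportᶜ, ∑ i, z i * S.winding i q = -c := by
      intro q hq
      let F : componentsIn S.supportᶜ := ⟨_, q, hq, rfl⟩
      have hrepF : rep F ∈ F.1 := by
        rw [hF F]
        exact mem_connectedComponentIn (hrep F)
      rw [S.sum_winding_eq_of_mem_componentsIn hz F.2 (mem_connectedComponentIn hq) hrepF]
      exact eq_neg_of_add_eq_zero_left (congrFun h F)
    obtain rfl := S.eq_zero_of_sum_winding_eq_const hconst
    obtain ⟨q, hq⟩ := S.dense_compl_support.nonempty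
    simpa using hconst q hq
  have := LinearMap.finrank_le_finrank_of_injective hΦ
  rwa [Module.finrank_prod, Module.finrank_self, Module.finrank_fintype_fun_eq_card,
    ← Nat.card_eq_fintype_card] at this

theorem card_add_one_le : (Fintype.card ι : ℕ∞) + 1 ≤
    (componentsIn S.supportᶜ).encard + S.endpoints.encard := by
  rcases (componentsIn S.supportᶜ).finite_or_infinite with hfin | hinf
  · have hker := S.finrank_ker_boundary_add_one_le hfin
    have hrange := S.finrank_range_boundary_le
    have hrank := LinearMap.finrank_range_add_finrank_ker S.boundary
    rw [Module.finrank_fintype_fun_eq_card] at hrank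
    rw [← hfin.cast_ncard_eq, ← S.finite_endpoints.cast_ncard_eq]
    norm_cast
    linarith
  · rw [hinf.encard_eq, top_add]
    exact le_top

end SegmentDrawing

theorem exists_minimal_return {α : Type*} {w : ℕ → α} (hw : ¬ Function.Injective w) :
    ∃ i m, 0 < m ∧ w (i + m) = w i ∧ InjOn w (Ico i (i + m)) := by
  classical
  have hreturn : ∃ m, 0 < m ∧ ∃ i, w (i + m) = w i := by
    obtain ⟨a, b, hab, hne⟩ := Function.not_injective_iff.1 hw
    rcases lt_or_gt_of_ne hne with hlt | hlt
    · exact ⟨b - a, Nat.sub_pos_of_lt hlt, a, by rw [Nat.add_sub_cancel' hlt.le, hab]⟩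
    · exact ⟨a - b, Nat.sub_pos_of_lt hlt, b, by rw [Nat.add_sub_cancel' hlt.le, hab]⟩
  obtain ⟨hpos, i, hi⟩ := Nat.find_spec hreturn
  have ne_of_lt : ∀ a b, i ≤ a → a < b → b < i + Nat.find hreturn → w b ≠ w a := by
    intro a b hia hab hb h
    exact Nat.find_min hreturn (m := b - a) (by omega)
      ⟨Nat.sub_pos_of_lt hab, a, by rwa [Nat.add_sub_cancel' hab.le]⟩
  refine ⟨i, Nat.find hreturn, hpos, hi, fun a ha b hb hab => ?_⟩
  rcases lt_trichotomy a b with hlt | heq | hlt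
  · exact absurd hab.symm (ne_of_lt a b ha.1 hlt hb.2)
  · exact heq
  · exact absurd hab (ne_of_lt b a hb.1 hlt ha.2)

section Graph

variable {α β : Type*} {G : Graph α β}

section Cycle

variable {w : ℕ → α} {d : ℕ → β} {i m : ℕ}

theorem injOn_edges_of_injOn_vertices (hlink : ∀ k, G.IsLink (d k) (w k) (w (k + 1)))
    (hd : ∀ k, d (k + 1) ≠ d k) (hw : InjOn w (Ico i (i + m))) : InjOn d (Ico i (i + m)) := by
  have ne_of_lt : ∀ a ∈ Ico i (i + m), ∀ b ∈ Ico i (i + m), a < b → d a ≠ d b := by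
    intro a ha b hb hab h
    rcases (hlink a).eq_and_eq_or_eq_and_eq (h ▸ hlink b) with ⟨hwab, -⟩ | ⟨-, hwab⟩
    · exact hab.ne (hw ha hb hwab)
    · obtain rfl : a + 1 = b := hw ⟨ha.1.trans a.le_succ, (Nat.succ_le_of_lt hab).trans_lt hb.2⟩
        hb hwab
      exact hd a h.symm
  intro a ha b hb hab
  rcases lt_trichotomy a b with hlt | heq | hlt
  · exact absurd hab (ne_of_lt a ha b hb hlt)
  · exact heq
  · exact absurd hab.symm (ne_of_lt b hb a ha hlt)

theorem isCycle_of_minimal_return (hlink : ∀ k, G.IsLink (d k) (w k) (w (k + 1)))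
    (hd : ∀ k, d (k + 1) ≠ d k) (hm : 0 < m) (hreturn : w (i + m) = w i)
    (hw : InjOn w (Ico i (i + m))) :
    G.IsCycle m (fun k => w (i + k)) (fun k => d (i + k)) := by
  have mem_Ico : ∀ k : Fin m, i + k ∈ Ico i (i + m) := fun k => by simp
  have hinj := injOn_edges_of_injOn_vertices hlink hd hw
  refine ⟨hm, fun a b h => ?_, fun a b h => ?_, fun k => ?_⟩
  · exact Fin.ext (Nat.add_left_cancel (hw (mem_Ico a) (mem_Ico b) h))
  · exact Fin.ext (Nat.add_left_cancel (hinj (mem_Ico a) (mem_Ico b) h))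
  · obtain ⟨n, rfl⟩ := Nat.exists_eq_add_one_of_ne_zero hm.ne'
    have hk := hlink (i + k)
    rw [finRotate_apply]
    rcases eq_or_ne k (Fin.last n) with rfl | hlast
    · simpa [hreturn, add_assoc] using hk
    · rwa [Fin.val_add_one_of_lt (Fin.lt_last_iff_ne_last.2 hlast)]

theorem exists_nonbacktracking_walk {K : Set β} (hK : (E(G) ∩ K).Nonempty)
    (hcont : ∀ e ∈ K, ∀ x y, G.IsLink e x y → ∃ f ∈ K, f ≠ e ∧ G.Inc f y) :
    ∃ (w : ℕ → α) (d : ℕ → β), (∀ k, G.IsLink (d k) (w k) (w (k + 1))) ∧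
      (∀ k, d (k + 1) ≠ d k) ∧ ∀ k, d k ∈ K := by
  obtain ⟨e, he, heK⟩ := hK
  obtain ⟨x, y, hxy⟩ := Graph.exists_isLink_of_mem_edgeSet he
  let Dart := {t : α × β × α // t.2.1 ∈ K ∧ G.IsLink t.2.1 t.1 t.2.2}
  have hnext : ∀ t : Dart, ∃ t' : Dart, t'.1.1 = t.1.2.2 ∧ t'.1.2.1 ≠ t.1.2.1 := by
    rintro ⟨⟨x, e, y⟩, he, hl⟩
    obtain ⟨f, hf, hfe, z, hz⟩ := hcont e he x y hl
    exact ⟨⟨⟨y, f, z⟩, hf, hz⟩, rfl, hfe⟩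
  choose next hvertex hedge using hnext
  let seq : ℕ → Dart := fun k => next^[k] ⟨⟨x, e, y⟩, heK, hxy⟩
  have hseq : ∀ k, seq (k + 1) = next (seq k) := fun k => Function.iterate_succ_apply' _ _ _
  refine ⟨fun k => (seq k).1.1, fun k => (seq k).1.2.1, fun k => ?_, fun k => ?_,
    fun k => (seq k).2.1⟩
  · have hk := (seq k).2.2
    rwa [← hvertex, ← hseq] at hk
  · have hk := hedge (seq k)
    rwa [← hseq] at hk

theorem isCycle_one_of_isLink {e : β} {x : α} (h : G.IsLink e x x) :
    G.IsCycle 1 (fun _ => x) (fun _ => e) :=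
  ⟨one_pos, Function.injective_of_subsingleton _, Function.injective_of_subsingleton _, fun _ => h⟩

theorem exists_isCycle_of_forall_exists_ne_inc (hV : V(G).Finite) {K : Set β}
    (hK : (E(G) ∩ K).Nonempty)
    (hcont : ∀ e ∈ K, ∀ x y, G.IsLink e x y → x ≠ y → ∃ f ∈ K, f ≠ e ∧ G.Inc f y) :
    ∃ (n : ℕ) (v : Fin n → α) (e : Fin n → β), G.IsCycle n v e ∧ ∀ i, e i ∈ K := by
  by_cases hloop : ∃ e ∈ K, ∃ x, G.IsLink e x x
  · obtain ⟨e, he, x, hx⟩ := hloop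
    exact ⟨1, _, _, isCycle_one_of_isLink hx, fun _ => he⟩
  · push Not at hloop
    obtain ⟨w, d, hlink, hd, hdK⟩ := exists_nonbacktracking_walk hK fun e he x y hxy =>
      hcont e he x y hxy (by rintro rfl; exact hloop e he _ hxy)
    have hw : ¬ Function.Injective w := fun hinj => infinite_univ <|
      Finite.of_injOn (fun k _ => (hlink k).left_mem) hinj.injOn hV
    obtain ⟨i, m, hm, hreturn, hinj⟩ := exists_minimal_return hw
    exact ⟨m, _, _, isCycle_of_minimal_return hlink hd hm hreturn hinj, fun k => hdK _⟩

end Cycle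

section Degree

theorem exists_inc_of_encard_pos {x : α}
    (h : 0 < (G.incidenceSet x).encard + (G.loopSet x).encard) : ∃ e, G.Inc e x := by
  by_contra! hinc
  have hincidence : G.incidenceSet x = ∅ := eq_empty_of_forall_notMem hinc
  have hloop : G.loopSet x = ∅ := eq_empty_of_forall_notMem fun e he => hinc e he.inc
  simp [hincidence, hloop] at h

theorem finite_vertexSet_of_forall_exists_inc (hE : E(G).Finite)
    (hinc : ∀ x ∈ V(G), ∃ e, G.Inc e x) : V(G).Finite := by
  refine (hE.biUnion (t := fun e => {x | G.Inc e x}) fun e he => ?_).subset fun x hx => ?_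
  · obtain ⟨x, y, hxy⟩ := Graph.exists_isLink_of_mem_edgeSet he
    exact (toFinite {x, y}).subset fun z hz => hz.eq_or_eq_of_isLink hxy
  · obtain ⟨e, he⟩ := hinc x hx
    exact mem_biUnion he.edge_mem he

theorem encard_incidenceSet_add_encard_loopSet {s t : E(G) → α}
    (hst : ∀ e : E(G), G.IsLink e (s e) (t e)) (x : α) :
    (G.incidenceSet x).encard + (G.loopSet x).encard =
      (s ⁻¹' {x}).encard + (t ⁻¹' {x}).encard := by
  have hinc : G.incidenceSet x = Subtype.val '' (s ⁻¹' {x} ∪ t ⁻¹' {x}) := by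
    ext e
    constructor
    · intro he
      exact ⟨⟨e, he.edge_mem⟩, (he.eq_or_eq_of_isLink (hst ⟨e, he.edge_mem⟩)).imp Eq.symm Eq.symm,
        rfl⟩
    · rintro ⟨e, rfl | rfl, rfl⟩
      · exact (hst e).inc_left
      · exact (hst e).inc_right
  have hloop : G.loopSet x = Subtype.val '' (s ⁻¹' {x} ∩ t ⁻¹' {x}) := by
    ext e
    constructor
    · intro he
      exact ⟨⟨e, he.edge_mem⟩, ⟨(he.eq_of_inc (hst ⟨e, he.edge_mem⟩).inc_left).symm,
        (he.eq_of_inc (hst ⟨e, he.edge_mem⟩).inc_right).symm⟩, rfl⟩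
    · rintro ⟨e, ⟨hs, ht⟩, rfl⟩
      have he := hst e
      rwa [mem_singleton_iff.1 hs, mem_singleton_iff.1 ht] at he
  rw [hinc, hloop, Subtype.val_injective.encard_image, Subtype.val_injective.encard_image,
    encard_union_add_encard_inter]

theorem mul_ncard_vertexSet_le (hE : E(G).Finite) (hV : V(G).Finite) {k : ℕ}
    (hdeg : ∀ x ∈ V(G), k ≤ (G.incidenceSet x).encard + (G.loopSet x).encard) :
    k * V(G).ncard ≤ 2 * E(G).ncard := by
  classical
  have := hE.fintype
  choose s t hst using fun e : E(G) => Graph.exists_isLink_of_mem_edgeSet e.2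
  have sum_fibers : ∀ u : E(G) → α, (∀ e, u e ∈ V(G)) →
      ∑ x ∈ hV.toFinset, (u ⁻¹' {x}).ncard = E(G).ncard := by
    intro u hu
    rw [← Nat.card_coe_set_eq, Nat.card_eq_fintype_card, ← Finset.card_univ,
      Finset.card_eq_sum_card_fiberwise (f := u) (t := hV.toFinset) fun e _ => by simpa using hu e]
    refine Finset.sum_congr rfl fun x _ => ?_
    rw [ncard_eq_toFinset_card']
    congr 1
    ext e
    simp
  have hfiber : ∀ x ∈ hV.toFinset, k ≤ (s ⁻¹' {x}).ncard + (t ⁻¹' {x}).ncard := by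
    intro x hx
    have h := hdeg x (hV.mem_toFinset.1 hx)
    rw [encard_incidenceSet_add_encard_loopSet hst, ← (toFinite _).cast_ncard_eq,
      ← (toFinite (t ⁻¹' {x})).cast_ncard_eq] at h
    exact_mod_cast h
  calc k * V(G).ncard = ∑ _x ∈ hV.toFinset, k := by
        rw [Finset.sum_const, ncard_eq_toFinset_card _ hV, smul_eq_mul, mul_comm]
    _ ≤ ∑ x ∈ hV.toFinset, ((s ⁻¹' {x}).ncard + (t ⁻¹' {x}).ncard) := Finset.sum_le_sum hfiber
    _ = 2 * E(G).ncard := by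
        rw [Finset.sum_add_distrib, sum_fibers s fun e => (hst e).left_mem,
          sum_fibers t fun e => (hst e).right_mem, two_mul]

theorem Graph.IsCubic.finite_edgeSet (hG : G.IsCubic) (hV : V(G).Finite) : E(G).Finite := by
  refine (hV.biUnion (t := G.incidenceSet) fun x hx => ?_).subset fun e he => ?_
  · exact finite_of_encard_le_coe (k := 3) (le_self_add.trans (hG x hx).le)
  · obtain ⟨x, y, hxy⟩ := Graph.exists_isLink_of_mem_edgeSet he
    exact mem_biUnion hxy.left_mem hxy.inc_left

end Degree

end Graph

section PolygonalCurve

variable (p : ℕ → ℝ × ℝ) (k : ℕ)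

theorem polygonalCurve_natCast_add {s : ℝ} (hs : s ∈ Icc (0 : ℝ) 1) :
    Graph.polygonalCurve p (k + s) = AffineMap.lineMap (p k) (p (k + 1)) s := by
  rcases hs.2.eq_or_lt with rfl | h1
  · rw [Graph.polygonalCurve, ← Nat.cast_add_one, Nat.floor_natCast]
    simp
  · have hfloor : ⌊(k : ℝ) + s⌋₊ = k := by
      rw [add_comm, Nat.floor_add_natCast hs.1, Nat.floor_eq_zero.2 h1, zero_add]
    have hfract : Int.fract ((k : ℝ) + s) = s := by
      rw [Int.fract_natCast_add, Int.fract_eq_self.2 ⟨hs.1, h1⟩]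
    rw [Graph.polygonalCurve, hfloor, hfract]

theorem polygonalCurve_natCast : Graph.polygonalCurve p k = p k := by
  simpa using polygonalCurve_natCast_add p k (left_mem_Icc.2 zero_le_one)

theorem image_polygonalCurve_Icc :
    Graph.polygonalCurve p '' Icc k (k + 1) = segment ℝ (p k) (p (k + 1)) := by
  have hIcc : Icc (k : ℝ) (k + 1) = (fun s => (k : ℝ) + s) '' Icc 0 1 := by
    simp [add_comm]
  rw [hIcc, image_image, segment_eq_image_lineMap]
  exact image_congr fun s hs => polygonalCurve_natCast_add p k hs

theorem image_polygonalCurve_Ioo :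
    Graph.polygonalCurve p '' Ioo k (k + 1) = openSegment ℝ (p k) (p (k + 1)) := by
  have hIoo : Ioo (k : ℝ) (k + 1) = (fun s => (k : ℝ) + s) '' Ioo 0 1 := by
    simp [add_comm]
  rw [hIoo, image_image, openSegment_eq_image_lineMap]
  exact image_congr fun s hs => polygonalCurve_natCast_add p k (Ioo_subset_Icc_self hs)

theorem Icc_zero_natCast_eq_iUnion {n : ℕ} (hn : 0 < n) :
    Icc (0 : ℝ) n = ⋃ k : Fin n, Icc (k : ℝ) (k + 1) := by
  refine Subset.antisymm (fun t ht => mem_iUnion.2 ?_) (iUnion_subset fun k => ?_)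
  · rcases ht.2.eq_or_lt with rfl | htn
    · exact ⟨⟨n - 1, by omega⟩, by simp [Nat.cast_pred hn]⟩
    · exact ⟨⟨⌊t⌋₊, (Nat.floor_lt ht.1).2 htn⟩, Nat.floor_le ht.1, (Nat.lt_floor_add_one t).le⟩
  · exact Icc_subset_Icc (Nat.cast_nonneg _) (by exact_mod_cast k.2)

end PolygonalCurve

namespace Graph.PlaneDrawing

variable {α β : Type*} {G : Graph α β} (D : G.PlaneDrawing)

section Segments

variable {e f : β} {x : α} {c : ℕ}

theorem corner_mem_image_point (he : e ∈ E(G)) (hc : c = 0 ∨ c = D.segments e) :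
    D.corner e c ∈ D.point '' V(G) := by
  obtain ⟨x, y, hxy, hx, hy⟩ := D.ends e he
  rcases hc with rfl | rfl
  · exact ⟨x, hxy.left_mem, hx.symm⟩
  · exact ⟨y, hxy.right_mem, hy.symm⟩

theorem eq_of_polygonalCurve_eq (he : e ∈ E(G)) (hf : f ∈ E(G)) {s t : ℝ}
    (hs : s ∈ Ioo 0 (D.segments e : ℝ)) (ht : t ∈ Icc 0 (D.segments f : ℝ))
    (h : polygonalCurve (D.corner f) t = polygonalCurve (D.corner e) s) : f = e ∧ t = s := by
  have ht' : t ∈ Ioo 0 (D.segments f : ℝ) := by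
    have not_end : ∀ c : ℕ, c = 0 ∨ c = D.segments f → (c : ℝ) ≠ t := by
      rintro c hc rfl
      obtain ⟨x, hx, hxc⟩ := D.corner_mem_image_point hf hc
      rw [polygonalCurve_natCast, ← hxc] at h
      exact D.vertex_notMem e he x hx ⟨s, hs, h.symm⟩
    exact ⟨ht.1.lt_of_ne (by exact_mod_cast not_end 0 (Or.inl rfl)),
      ht.2.lt_of_ne (not_end _ (Or.inr rfl)).symm⟩
  by_cases hfe : f = e
  · subst hfe
    exact ⟨rfl, D.curve_injOn f hf ht' hs h⟩
  · exact absurd ⟨s, hs, rfl⟩ (disjoint_left.1 (D.edge_disjoint f hf e he hfe) ⟨t, ht', h⟩)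

theorem corner_ne_corner_succ (he : e ∈ E(G)) {k : ℕ} (hk : k < D.segments e) :
    D.corner e k ≠ D.corner e (k + 1) := by
  intro h
  have hsub : Ioo (k : ℝ) (k + 1) ⊆ Ioo 0 (D.segments e : ℝ) :=
    Ioo_subset_Ioo (Nat.cast_nonneg k) (by exact_mod_cast hk)
  have hnontrivial := (Ioo_infinite (lt_add_one (k : ℝ))).nontrivial.image_of_injOn
    ((D.curve_injOn e he).mono hsub)
  rw [image_polygonalCurve_Ioo, ← h, openSegment_same] at hnontrivial
  exact not_nontrivial_singleton hnontrivial

theorem eq_of_mem_openSegment_of_mem_segment (he : e ∈ E(G)) (hf : f ∈ E(G)) {k l : ℕ}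
    (hk : k < D.segments e) (hl : l < D.segments f) {q : ℝ × ℝ}
    (hqe : q ∈ openSegment ℝ (D.corner e k) (D.corner e (k + 1)))
    (hqf : q ∈ segment ℝ (D.corner f l) (D.corner f (l + 1))) : f = e ∧ l = k := by
  rw [← image_polygonalCurve_Ioo] at hqe
  rw [← image_polygonalCurve_Icc] at hqf
  obtain ⟨s, hs, rfl⟩ := hqe
  obtain ⟨t, ht, h⟩ := hqf
  obtain ⟨rfl, rfl⟩ := D.eq_of_polygonalCurve_eq he hf
    (Ioo_subset_Ioo (Nat.cast_nonneg k) (by exact_mod_cast hk) hs)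
    (Icc_subset_Icc (Nat.cast_nonneg l) (by exact_mod_cast hl) ht) h
  have hkl : k < l + 1 := by exact_mod_cast hs.1.trans_le ht.2
  have hlk : l < k + 1 := by exact_mod_cast ht.1.trans_lt hs.2
  exact ⟨rfl, by omega⟩

/-- The segments of all the edges of a plane drawing, as a drawing of disjoint segments. -/
def segmentDrawing : SegmentDrawing (Σ e : E(G), Fin (D.segments e)) where
  src i := D.corner i.1 i.2
  tgt i := D.corner i.1 (i.2 + 1)
  src_ne_tgt i := D.corner_ne_corner_succ i.1.2 i.2.2
  disjoint := by
    rintro ⟨⟨e, he⟩, k⟩ ⟨⟨f, hf⟩, l⟩ hne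
    refine disjoint_left.2 fun q hqe hqf => hne ?_
    obtain ⟨rfl, hlk⟩ := D.eq_of_mem_openSegment_of_mem_segment he hf k.2 l.2 hqe hqf
    rw [Fin.ext hlk]

theorem arc_eq_iUnion (e : E(G)) : D.arc e = ⋃ k, D.segmentDrawing.seg ⟨e, k⟩ := by
  rw [arc, Icc_zero_natCast_eq_iUnion (D.segments_pos e e.2), image_iUnion]
  exact iUnion_congr fun k => image_polygonalCurve_Icc _ _

theorem point_mem_arc (h : G.Inc e x) : D.point x ∈ D.arc e := by
  obtain ⟨u, v, huv, hu, hv⟩ := D.ends e h.edge_mem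
  rcases h.eq_or_eq_of_isLink huv with rfl | rfl
  · exact ⟨(0 : ℕ), by simp, by rw [polygonalCurve_natCast, hu]⟩
  · exact ⟨D.segments e, by simp, by rw [polygonalCurve_natCast, hv]⟩

theorem support_eq_support_segmentDrawing (hinc : ∀ x ∈ V(G), ∃ e, G.Inc e x) :
    D.support = D.segmentDrawing.support := by
  have hunion : ⋃ e ∈ E(G), D.arc e = D.segmentDrawing.support := by
    rw [SegmentDrawing.support, iUnion_sigma, biUnion_eq_iUnion]
    exact iUnion_congr D.arc_eq_iUnion
  rw [support, hunion, union_eq_right, ← hunion]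
  rintro _ ⟨x, hx, rfl⟩
  obtain ⟨e, he⟩ := hinc x hx
  exact mem_biUnion he.edge_mem (D.point_mem_arc he)

theorem faces_eq_componentsIn (hinc : ∀ x ∈ V(G), ∃ e, G.Inc e x) :
    D.faces = componentsIn D.segmentDrawing.supportᶜ := by
  rw [faces, D.support_eq_support_segmentDrawing hinc, componentsIn]

end Segments

section Corners

variable {e f : β} {x y : α} {c c' : ℕ}

theorem mem_ends_segmentDrawing {i : Σ e : E(G), Fin (D.segments e)} {q : ℝ × ℝ} :
    q ∈ D.segmentDrawing.ends i ↔ ∃ c : ℕ, (c = i.2 ∨ c = i.2 + 1) ∧ D.corner i.1 c = q := by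
  simp [SegmentDrawing.ends, segmentDrawing, or_and_right, exists_or, eq_comm]

theorem eq_of_corner_eq_corner (he : e ∈ E(G)) (hf : f ∈ E(G)) (hc0 : 0 < c)
    (hc : c < D.segments e) (hc' : c' ≤ D.segments f) (h : D.corner f c' = D.corner e c) :
    f = e ∧ c' = c := by
  rw [← polygonalCurve_natCast (D.corner f), ← polygonalCurve_natCast (D.corner e)] at h
  obtain ⟨hfe, hcc⟩ := D.eq_of_polygonalCurve_eq he hf
    ⟨Nat.cast_pos.2 hc0, Nat.cast_lt.2 hc⟩ ⟨Nat.cast_nonneg _, Nat.cast_le.2 hc'⟩ h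
  exact ⟨hfe, Nat.cast_injective hcc⟩

theorem eq_zero_or_eq_segments_of_corner_eq_point (he : e ∈ E(G)) (hc : c ≤ D.segments e)
    (hy : y ∈ V(G)) (h : D.corner e c = D.point y) : c = 0 ∨ c = D.segments e := by
  by_contra! hne
  exact D.vertex_notMem e he y hy ⟨c, ⟨Nat.cast_pos.2 (Nat.pos_of_ne_zero hne.1),
    Nat.cast_lt.2 (hc.lt_of_ne hne.2)⟩, by rw [polygonalCurve_natCast, h]⟩

theorem inc_of_corner_eq_point (he : e ∈ E(G)) (hc : c ≤ D.segments e) (hy : y ∈ V(G))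
    (h : D.corner e c = D.point y) : G.Inc e y := by
  obtain ⟨u, v, huv, hu, hv⟩ := D.ends e he
  rcases D.eq_zero_or_eq_segments_of_corner_eq_point he hc hy h with rfl | rfl
  · exact D.point_injOn huv.left_mem hy (hu.symm.trans h) ▸ huv.inc_left
  · exact D.point_injOn huv.right_mem hy (hv.symm.trans h) ▸ huv.inc_right

theorem corner_zero_ne_corner_segments (h : G.IsLink e x y) (hxy : x ≠ y) :
    D.corner e 0 ≠ D.corner e (D.segments e) := by
  obtain ⟨u, v, huv, hu, hv⟩ := D.ends e h.edge_mem
  rw [hu, hv]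
  intro huv'
  obtain rfl := D.point_injOn huv.left_mem huv.right_mem huv'
  obtain ⟨rfl, rfl⟩ | ⟨rfl, rfl⟩ := h.eq_and_eq_or_eq_and_eq huv <;> exact hxy rfl

theorem eq_of_corner_eq_point (h : G.IsLink e x y) (hxy : x ≠ y) (hc : c ≤ D.segments e)
    (hc' : c' ≤ D.segments e) (hcy : D.corner e c = D.point y)
    (hcy' : D.corner e c' = D.point y) : c = c' := by
  have hne := D.corner_zero_ne_corner_segments h hxy
  rcases D.eq_zero_or_eq_segments_of_corner_eq_point h.edge_mem hc h.right_mem hcy with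
    rfl | rfl <;>
  rcases D.eq_zero_or_eq_segments_of_corner_eq_point h.edge_mem hc' h.right_mem hcy' with
    rfl | rfl
  · rfl
  · exact absurd (hcy.trans hcy'.symm) hne
  · exact absurd (hcy'.trans hcy.symm) hne
  · rfl

theorem exists_point_mem_ends (h : G.Inc e y) :
    ∃ k : Fin (D.segments e), D.point y ∈ D.segmentDrawing.ends ⟨⟨e, h.edge_mem⟩, k⟩ := by
  have hpos := D.segments_pos e h.edge_mem
  obtain ⟨u, v, huv, hu, hv⟩ := D.ends e h.edge_mem
  rcases h.eq_or_eq_of_isLink huv with rfl | rfl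
  · exact ⟨⟨0, hpos⟩, D.mem_ends_segmentDrawing.2 ⟨0, Or.inl rfl, hu⟩⟩
  · exact ⟨⟨D.segments e - 1, Nat.sub_one_lt hpos.ne'⟩, D.mem_ends_segmentDrawing.2
      ⟨D.segments e, Or.inr (Nat.sub_add_cancel hpos).symm, hv⟩⟩

end Corners

section Euler

theorem endpoints_segmentDrawing_subset : D.segmentDrawing.endpoints ⊆ D.point '' V(G) ∪
    range fun i : Σ e : E(G), Fin (D.segments e - 1) => D.corner i.1 (i.2 + 1) := by
  refine iUnion_subset fun i q hq => ?_
  obtain ⟨c, hc, rfl⟩ := D.mem_ends_segmentDrawing.1 hq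
  by_cases hend : c = 0 ∨ c = D.segments i.1
  · exact Or.inl (D.corner_mem_image_point i.1.2 hend)
  · have := i.2.2
    exact Or.inr ⟨⟨i.1, ⟨c - 1, by omega⟩⟩, congrArg (D.corner i.1) (by simp only; omega)⟩

/-- Subdividing an edge adds one edge and one vertex. -/
theorem encard_edgeSet_add_one_le [Finite E(G)] : E(G).encard + 1 ≤
    (componentsIn D.segmentDrawing.supportᶜ).encard + V(G).encard := by
  have := Fintype.ofFinite E(G)
  have hendpoints : D.segmentDrawing.endpoints.encard ≤
      V(G).encard + ((∑ e : E(G), (D.segments e - 1) : ℕ) : ℕ∞) := by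
    refine (encard_le_encard D.endpoints_segmentDrawing_subset).trans <|
      (encard_union_le _ _).trans (add_le_add (encard_image_le _ _) ?_)
    rw [← image_univ]
    refine (encard_image_le _ _).trans_eq ?_
    rw [encard_univ, ENat.card_eq_coe_fintype_card, Fintype.card_sigma]
    simp
  have hsegments : (Fintype.card (Σ e : E(G), Fin (D.segments e)) : ℕ∞) =
      E(G).encard + ((∑ e : E(G), (D.segments e - 1) : ℕ) : ℕ∞) := by
    rw [encard_eq_coe_toFinset_card, toFinset_card, ← Nat.cast_add, Fintype.card_sigma,
      Fintype.card_eq_sum_ones, ← Finset.sum_add_distrib]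
    exact congrArg Nat.cast <| Finset.sum_congr rfl fun e _ => by
      rw [Fintype.card_fin, Nat.add_sub_cancel' (D.segments_pos e e.2)]
  have hEuler := D.segmentDrawing.card_add_one_le.trans (add_le_add_right hendpoints _)
  rw [hsegments, ← add_assoc, add_right_comm] at hEuler
  exact (ENat.add_le_add_iff_right (ENat.natCast_ne_top _)).1 hEuler

end Euler

section Border

variable [Finite E(G)] {F F' : Set (ℝ × ℝ)}

theorem seg_subset_of_corner_mem_ends (h : IsOpenPartition D.segmentDrawing.supportᶜ F F')
    {e : E(G)} {k l : Fin (D.segments e)} {c : ℕ} (hc0 : 0 < c) (hc : c < D.segments e)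
    (hck : c = k ∨ c = k + 1) (hcl : c = l ∨ c = l + 1) (hkl : k ≠ l)
    (hk : D.segmentDrawing.seg ⟨e, k⟩ ⊆ closure F ∩ closure F') :
    D.segmentDrawing.seg ⟨e, l⟩ ⊆ closure F ∩ closure F' := by
  obtain ⟨⟨f, m⟩, hne, hends, hm⟩ := D.segmentDrawing.exists_ne_seg_subset h
    (D.mem_ends_segmentDrawing.2 ⟨c, hck, rfl⟩) hk
  obtain ⟨c', hcm, hcc⟩ := D.mem_ends_segmentDrawing.1 hends
  have hm2 := m.2
  obtain ⟨hfe, rfl⟩ := D.eq_of_corner_eq_corner e.2 f.2 hc0 hc (by simp only at hcm; omega) hcc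
  obtain rfl : f = e := Subtype.ext hfe
  have hmk : m ≠ k := fun h => hne (by rw [h])
  obtain rfl : m = l := by
    rw [Ne, Fin.ext_iff] at hmk hkl
    simp only at hcm
    exact Fin.ext (by omega)
  exact hm

theorem arc_subset_of_seg_subset (h : IsOpenPartition D.segmentDrawing.supportᶜ F F') {e : E(G)}
    {k : Fin (D.segments e)} (hk : D.segmentDrawing.seg ⟨e, k⟩ ⊆ closure F ∩ closure F') :
    D.arc e ⊆ closure F ∩ closure F' := by
  have seg_iff_seg_zero : ∀ l (hl : l < D.segments e),
      D.segmentDrawing.seg ⟨e, ⟨l, hl⟩⟩ ⊆ closure F ∩ closure F' ↔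
        D.segmentDrawing.seg ⟨e, ⟨0, D.segments_pos e e.2⟩⟩ ⊆ closure F ∩ closure F' := by
    intro l hl
    induction l with
    | zero => rfl
    | succ l ih =>
      rw [← ih (Nat.lt_of_succ_lt hl)]
      exact ⟨D.seg_subset_of_corner_mem_ends h l.succ_pos hl (Or.inl rfl) (Or.inr rfl) (by simp),
        D.seg_subset_of_corner_mem_ends h l.succ_pos hl (Or.inr rfl) (Or.inl rfl) (by simp)⟩
  rw [arc_eq_iUnion]
  exact iUnion_subset fun l => (seg_iff_seg_zero l l.2).2 ((seg_iff_seg_zero k k.2).1 hk)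

theorem exists_ne_inc_arc_subset (h : IsOpenPartition D.segmentDrawing.supportᶜ F F') {e : β}
    {x y : α} (hl : G.IsLink e x y) (hxy : x ≠ y) (he : D.arc e ⊆ closure F ∩ closure F') :
    ∃ f ≠ e, G.Inc f y ∧ D.arc f ⊆ closure F ∩ closure F' := by
  obtain ⟨k, hk⟩ := D.exists_point_mem_ends hl.inc_right
  obtain ⟨⟨f, m⟩, hne, hends, hm⟩ := D.segmentDrawing.exists_ne_seg_subset h hk <|
    (subset_iUnion _ k).trans ((D.arc_eq_iUnion ⟨e, hl.edge_mem⟩).ge.trans he)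
  obtain ⟨c, hck, hcy⟩ := D.mem_ends_segmentDrawing.1 hk
  obtain ⟨c', hcm, hcy'⟩ := D.mem_ends_segmentDrawing.1 hends
  simp only at hck hcm
  have hc : c ≤ D.segments e := by have := k.2; omega
  have hc' : c' ≤ D.segments f := by have := m.2; omega
  refine ⟨f, fun hfe => hne ?_, D.inc_of_corner_eq_point f.2 hc' hl.right_mem hcy',
    D.arc_subset_of_seg_subset h hm⟩
  obtain rfl : f = ⟨e, hl.edge_mem⟩ := Subtype.ext hfe
  obtain rfl := D.eq_of_corner_eq_point hl hxy hc hc' hcy hcy'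
  have hend := D.eq_zero_or_eq_segments_of_corner_eq_point hl.edge_mem hc hl.right_mem hcy
  have hmk : m = k := Fin.ext (by have := m.2; have := k.2; simp only at *; omega)
  rw [hmk]

end Border

end Graph.PlaneDrawing

namespace Graph.PlaneDrawing

variable {α β : Type*} {G : Graph α β} (D : G.PlaneDrawing) [Finite E(G)]

theorem exists_finset_subset_componentsIn (hV : V(G).Finite) :
    ∃ T : Finset (Set (ℝ × ℝ)), ↑T ⊆ componentsIn D.segmentDrawing.supportᶜ ∧
      E(G).ncard + 1 ≤ T.card + V(G).ncard := by
  have hEuler := D.encard_edgeSet_add_one_le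
  rw [← hV.cast_ncard_eq, ← E(G).toFinite.cast_ncard_eq] at hEuler
  obtain ⟨t, ht, htcard⟩ := exists_subset_encard_eq (s := componentsIn D.segmentDrawing.supportᶜ)
    (k := (E(G).ncard + 1 - V(G).ncard : ℕ))
    (by rw [ENat.natCast_sub]; exact tsub_le_iff_right.2 (by exact_mod_cast hEuler))
  have htfin : t.Finite := finite_of_encard_eq_coe htcard
  refine ⟨htfin.toFinset, by simpa using ht, ?_⟩
  rw [htfin.encard_eq_coe_toFinset_card, Nat.cast_inj] at htcard
  omega

theorem encard_setOf_mem_boundaryEdges_le_two (e : E(G)) :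
    {F ∈ componentsIn D.segmentDrawing.supportᶜ | (e : β) ∈ D.boundaryEdges F}.encard ≤ 2 := by
  let i : Σ e : E(G), Fin (D.segments e) := ⟨e, 0, D.segments_pos e e.2⟩
  obtain ⟨p, hp⟩ : (D.segmentDrawing.openSeg i).Nonempty :=
    ⟨_, midpoint_mem_openSegment _ _⟩
  have hsub : {F ∈ componentsIn D.segmentDrawing.supportᶜ | (e : β) ∈ D.boundaryEdges F} ⊆
      {F ∈ componentsIn D.segmentDrawing.supportᶜ | p ∈ closure F} := by
    refine fun F hF => ⟨hF.1, frontier_subset_closure (hF.2.2 ?_)⟩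
    rw [arc_eq_iUnion]
    exact mem_iUnion_of_mem _ (D.segmentDrawing.openSeg_subset_seg hp)
  exact (encard_le_encard hsub).trans (D.segmentDrawing.encard_componentsIn_closure_le_two hp)

theorem exists_encard_boundaryEdges_le {T : Finset (Set (ℝ × ℝ))}
    (hT : ↑T ⊆ componentsIn D.segmentDrawing.supportᶜ) {k : ℕ}
    (hk : E(G).ncard * 2 < T.card * (k + 1)) : ∃ F ∈ T, (D.boundaryEdges F).encard ≤ k := by
  classical
  by_contra! hlarge
  refine hk.not_ge ?_
  rw [ncard_eq_toFinset_card E(G)]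
  refine Finset.card_mul_le_card_mul (fun F e => e ∈ D.boundaryEdges F) (fun F hF => ?_)
    fun e he => ?_
  · have hsub : D.boundaryEdges F ⊆
        E(G).toFinite.toFinset.bipartiteAbove (fun F e => e ∈ D.boundaryEdges F) F := by
      intro e he
      simpa using ⟨he.1, he⟩
    have hlt := (hlarge F hF).trans_le (encard_le_encard hsub)
    rw [encard_coe_eq_coe_finsetCard] at hlt
    exact_mod_cast hlt
  · have hsub : ↑(T.bipartiteBelow (fun F e => e ∈ D.boundaryEdges F) e) ⊆
        {F ∈ componentsIn D.segmentDrawing.supportᶜ | e ∈ D.boundaryEdges F} := by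
      intro F hF
      obtain ⟨hFT, hFe⟩ := (Finset.mem_bipartiteBelow _).1 hF
      exact ⟨hT hFT, hFe⟩
    have hle := (encard_le_encard hsub).trans
      (D.encard_setOf_mem_boundaryEdges_le_two ⟨e, E(G).toFinite.mem_toFinset.1 he⟩)
    rw [encard_coe_eq_coe_finsetCard] at hle
    exact_mod_cast hle

theorem exists_isCycle_boundaryEdges (hV : V(G).Finite) {F : Set (ℝ × ℝ)}
    (hF : F ∈ componentsIn D.segmentDrawing.supportᶜ)
    (hnontrivial : (componentsIn D.segmentDrawing.supportᶜ).Nontrivial) :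
    ∃ (n : ℕ) (v : Fin n → α) (e : Fin n → β), G.IsCycle n v e ∧ ∀ i, e i ∈ D.boundaryEdges F := by
  set U := D.segmentDrawing.supportᶜ
  have h : IsOpenPartition U F (U \ F) :=
    isOpenPartition_of_mem_componentsIn D.segmentDrawing.isClosed_support.isOpen_compl hF
  obtain ⟨⟨e, k⟩, hk⟩ := D.segmentDrawing.exists_seg_subset h
    (nonempty_of_mem_componentsIn hF) (diff_nonempty_of_nontrivial_componentsIn hF hnontrivial)
  obtain ⟨n, v, e, hcycle, he⟩ := exists_isCycle_of_forall_exists_ne_inc hV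
    (K := {e | D.arc e ⊆ closure F ∩ closure (U \ F)}) ⟨e, e.2, D.arc_subset_of_seg_subset h hk⟩
    fun e he x y hl hxy => by
      obtain ⟨f, hfe, hf, harc⟩ := D.exists_ne_inc_arc_subset h hl hxy he
      exact ⟨f, harc, hfe, hf⟩
  exact ⟨n, v, e, hcycle, fun i =>
    ⟨(hcycle.isLink i).edge_mem, (he i).trans h.closure_inter_closure_subset_frontier⟩⟩

end Graph.PlaneDrawing

theorem Graph.IsCycle.le_encard {α β : Type*} {G : Graph α β} {n : ℕ} {v : Fin n → α}
    {e : Fin n → β} (h : G.IsCycle n v e) {K : Set β} (hK : ∀ i, e i ∈ K) : n ≤ K.encard := by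
  simpa using h.edge_injective.encard_range.trans (encard_le_encard (range_subset_iff.2 hK))

theorem lemma1_general {α β : Type*} (G : Graph α β) (hfin : E(G).Finite) (hne : V(G).Nonempty)
    (hdeg : ∀ x ∈ V(G), 3 ≤ (G.incidenceSet x).encard + (G.loopSet x).encard)
    (hplanar : G.IsPlanar) :
    G.egirth ≤ 5 ∧
    ∀ D : G.PlaneDrawing, ∃ F ∈ D.faces, (D.boundaryEdges F).encard ≤ 5 ∧
      ∃ (n : ℕ) (v : Fin n → α) (e : Fin n → β),
        G.IsCycle n v e ∧ n ≤ 5 ∧ ∀ i, e i ∈ D.boundaryEdges F := by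
  have : Finite E(G) := hfin
  have hinc : ∀ x ∈ V(G), ∃ e, G.Inc e x := fun x hx =>
    exists_inc_of_encard_pos (zero_lt_three.trans_le (hdeg x hx))
  have hV := finite_vertexSet_of_forall_exists_inc hfin hinc
  have hcard : 3 * V(G).ncard ≤ 2 * E(G).ncard := mul_ncard_vertexSet_le hfin hV hdeg
  have hVpos : 0 < V(G).ncard := (ncard_pos hV).2 hne
  have key : ∀ D : G.PlaneDrawing, ∃ F ∈ D.faces, (D.boundaryEdges F).encard ≤ 5 ∧
      ∃ (n : ℕ) (v : Fin n → α) (e : Fin n → β),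
        G.IsCycle n v e ∧ n ≤ 5 ∧ ∀ i, e i ∈ D.boundaryEdges F := by
    intro D
    rw [D.faces_eq_componentsIn hinc]
    obtain ⟨T, hT, hTcard⟩ := D.exists_finset_subset_componentsIn hV
    obtain ⟨F, hFT, hF⟩ := D.exists_encard_boundaryEdges_le hT (k := 5) (by omega)
    obtain ⟨n, v, e, hcycle, he⟩ := D.exists_isCycle_boundaryEdges hV (hT hFT)
      ((Finset.one_lt_card_iff_nontrivial.1 (by omega)).mono hT)
    exact ⟨F, hT hFT, hF, n, v, e, hcycle, by exact_mod_cast (hcycle.le_encard he).trans hF, he⟩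
  obtain ⟨D⟩ := hplanar
  obtain ⟨F, -, -, n, v, e, hcycle, hn, -⟩ := key D
  exact ⟨(iInf₂_le n ⟨v, e, hcycle⟩).trans (by exact_mod_cast hn), key⟩

theorem lemma1 {α β : Type*} (G : Graph α β) (hfin : V(G).Finite) (hne : V(G).Nonempty)
    (hcubic : G.IsCubic) (hbridgeless : G.IsBridgeless) (hplanar : G.IsPlanar) :
    G.egirth ≤ 5 ∧
    ∀ D : G.PlaneDrawing, ∃ F ∈ D.faces, (D.boundaryEdges F).encard ≤ 5 ∧
      ∃ (n : ℕ) (v : Fin n → α) (e : Fin n → β),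
        G.IsCycle n v e ∧ n ≤ 5 ∧ ∀ i, e i ∈ D.boundaryEdges F :=
  lemma1_general G (hcubic.finite_edgeSet hfin) hne (fun x hx => (hcubic x hx).ge) hplanar
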